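/- Let $\mathrm{PL}_0(I)$ be the group of orientation-preserving piecewise-linear homeomorphisms of $I=[0,1]$ with only finitely many points of non-differentiability; maps act on the right and products are in word order, so $t(fg)=(tf)g$, and $a^b=b^{-1}ab$. Thompson's group $F\le \mathrm{PL}_0(I)$ consists of those elements whose points of non-differentiability are all dyadic rationals and whose slopes are all integral powers of $2$. Let $x_0,x_1\in \mathrm{PL}_0(I)$ be given by $$ax_0=\begin{cases}2a&0\le a\le \frac14\\ a+\frac14&\frac14\le a\le\frac12\\ \frac a2+\frac12&\frac12\le a\le 1\end{cases}\qquad ax_1=\begin{cases}a&0\le a\le\frac12\\ 2a-\frac12&\frac12\le a\le\frac58\\ a+\frac18&\frac58\le a\le\frac34\\ \frac a2+\frac12&\frac34\le a\le1\end{cases}$$ and put $x_{k+1}=x_1^{x_0^k}$ for $k\ge 1$. For a subgroup $K\le \mathrm{PL}_0(I)$, let $\operatorname{Supp}(K)$ be the set of points of $I$ moved by some element of $K$; the orbitals of $K$ are the connected components of $\operatorname{Supp}(K)$, which are open intervals. For $h\in K$, an orbital $W$ of $K$ and an end point $e$ of $W$, say that $h|_W$ moves points near $e$ if $W$ contains points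 arbitrarily close to $e$ that are moved by $h$ (equivalently, $h$ is not the identity on the points of $W$ near $e$). Let $f_0=x_1^2x_2^{-1}x_1^{-1}$, $f_1=x_1x_2^2x_3^{-1}x_2^{-1}x_1^{-1}$ and $H=\langle x_0,f_0,f_1\rangle$. Then: 1. $\langle f_0,f_1\rangle\cong F$; 2. $(0,1)$ is the only orbital of $H$; 3. for every $h\in H$, $h|_{(0,1)}$ moves points near $0$ if and only if it moves points near $1$. Consequently, the full converse of the ubiquity theorem is false: it is not true that every $K\le \mathrm{PL}_0(I)$ containing a subgroup isomorphic to $F$ has an orbital $(a,b)$ and an element $h\in K$ such that $h|_{(a,b)}$ moves points near $a$ but not $b$, or near $b$ but not $a$. -/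

import Mathlib

namespace ThompsonPL

open Set Filter Topology

/-- `f` agrees with the affine map `y ↦ m y + c` on a neighbourhood of `x` in `[0,1]`. -/
def AffineNear (f : unitInterval → unitInterval) (x : unitInterval) (m c : ℝ) : Prop :=
  ∀ᶠ y in 𝓝 x, (f y : ℝ) = m * (y : ℝ) + c

/-- `x` is a break point of `f`: `f` is not affine on any neighbourhood of `x`.
For a piecewise-linear map these are exactly the points of non-differentiability. -/
def IsBreak (f : unitInterval → unitInterval) (x : unitInterval) : Prop :=
  ¬ ∃ m c : ℝ, AffineNear f x m c

theorem AffineNear.unique {f : unitInterval → unitInterval} {x : unitInterval} {m c m' c' : ℝ}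
    (h : AffineNear f x m c) (h' : AffineNear f x m' c') : m = m' ∧ c = c' := by
  have hx : (f x : ℝ) = m * x + c := h.self_of_nhds
  have hx' : (f x : ℝ) = m' * x + c' := h'.self_of_nhds
  have hinf := infinite_of_mem_nhds x (h.and h')
  obtain ⟨y, hy, hyx⟩ := (hinf.sdiff (Set.finite_singleton x)).nonempty
  have hne : (y : ℝ) - x ≠ 0 := by
    intro h0
    exact hyx (Subtype.ext (by linarith))
  obtain ⟨h1, h2⟩ := hy
  have : (m - m') * ((y : ℝ) - x) = 0 := by linarith
  have hm : m = m' := by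
    rcases mul_eq_zero.1 this with h | h
    · linarith
    · exact absurd h hne
  subst hm
  exact ⟨rfl, by linarith⟩

theorem AffineNear.eventually {f : unitInterval → unitInterval} {x : unitInterval} {m c : ℝ}
    (h : AffineNear f x m c) : ∀ᶠ y in 𝓝 x, AffineNear f y m c :=
  eventually_eventually_nhds.2 h

theorem AffineNear.slope_ne_zero {f : unitInterval → unitInterval} (hf : Function.Injective f)
    {x : unitInterval} {m c : ℝ} (h : AffineNear f x m c) : m ≠ 0 := by
  rintro rfl
  have hinf := infinite_of_mem_nhds x h
  obtain ⟨y, hy, hyx⟩ := (hinf.sdiff (Set.finite_singleton x)).nonempty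
  have hx : (f x : ℝ) = 0 * x + c := h.self_of_nhds
  have hy' : (f y : ℝ) = 0 * y + c := hy
  exact hyx (hf (Subtype.ext (by linarith)))

theorem AffineNear.comp {f g : unitInterval → unitInterval} (hf : Continuous f)
    {x : unitInterval} {m c m' c' : ℝ} (h : AffineNear f x m c) (h' : AffineNear g (f x) m' c') :
    AffineNear (g ∘ f) x (m' * m) (m' * c + c') := by
  have := hf.continuousAt.eventually h'
  filter_upwards [h, this] with y hy hy'
  simp only [Function.comp, hy', hy]
  ring

theorem AffineNear.symm (f : unitInterval ≃ₜ unitInterval) {x : unitInterval} {m c : ℝ}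
    (h : AffineNear f x m c) : AffineNear f.symm (f x) m⁻¹ (-(m⁻¹ * c)) := by
  have hm := h.slope_ne_zero f.injective
  have h1 : Tendsto f.symm (𝓝 (f x)) (𝓝 x) := by
    have := f.symm.continuous.tendsto (f x)
    rwa [f.symm_apply_apply] at this
  filter_upwards [h1.eventually h] with y hy
  rw [f.apply_symm_apply] at hy
  rw [hy]
  field_simp
  ring

theorem isBreak_comp (f g : unitInterval ≃ₜ unitInterval) {x : unitInterval}
    (h : IsBreak (f.trans g) x) : IsBreak f x ∨ IsBreak g (f x) := by
  by_contra hcon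
  simp only [IsBreak, not_or, not_not] at hcon
  obtain ⟨⟨m, c, h1⟩, ⟨m', c', h2⟩⟩ := hcon
  exact h ⟨_, _, h1.comp f.continuous h2⟩

theorem isBreak_symm (f : unitInterval ≃ₜ unitInterval) {y : unitInterval}
    (h : IsBreak f.symm y) : IsBreak f (f.symm y) := by
  rintro ⟨m, c, h1⟩
  have := h1.symm f
  rw [f.apply_symm_apply] at this
  exact h ⟨_, _, this⟩

theorem not_isBreak_refl (x : unitInterval) : ¬ IsBreak (Homeomorph.refl unitInterval) x :=
  not_not.2 ⟨1, 0, Eventually.of_forall fun y => by simp⟩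

/-- The orientation-preserving piecewise-linear homeomorphisms of `[0,1]` with finitely many
break points. -/
structure PL0 extends unitInterval ≃ₜ unitInterval where
  strictMono' : StrictMono toHomeomorph
  finite_breaks' : {x | IsBreak toHomeomorph x}.Finite

namespace PL0

instance : CoeFun PL0 fun _ => unitInterval → unitInterval := ⟨fun f => f.toHomeomorph⟩

@[ext] theorem ext {f g : PL0} (h : ∀ t, f t = g t) : f = g := by
  cases f; cases g
  congr
  exact Homeomorph.ext h

/-- Composition is in word order: `f * g` applies `f` first and then `g`. -/
instance : Mul PL0 where
  mul f g :=
    { toHomeomorph := f.toHomeomorph.trans g.toHomeomorph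
      strictMono' := g.strictMono'.comp f.strictMono'
      finite_breaks' :=
        (f.finite_breaks'.union
          (g.finite_breaks'.preimage f.toHomeomorph.injective.injOn)).subset
            fun _ hx => isBreak_comp _ _ hx }

instance : One PL0 where
  one :=
    { toHomeomorph := Homeomorph.refl _
      strictMono' := strictMono_id
      finite_breaks' := Set.finite_empty.subset fun x hx => (not_isBreak_refl x hx).elim }

instance : Inv PL0 where
  inv f :=
    { toHomeomorph := f.toHomeomorph.symm
      strictMono' := by
        intro a b hab
        rw [← f.strictMono'.lt_iff_lt]
        simpa using hab
      finite_breaks' :=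
        (f.finite_breaks'.preimage f.toHomeomorph.symm.injective.injOn).subset
          fun _ hx => isBreak_symm _ hx }

theorem mul_apply (f g : PL0) (t : unitInterval) : (f * g) t = g (f t) := rfl

theorem one_apply (t : unitInterval) : (1 : PL0) t = t := rfl

theorem inv_apply (f : PL0) (t : unitInterval) : f⁻¹ t = f.toHomeomorph.symm t := rfl

instance : Group PL0 where
  mul_assoc _ _ _ := rfl
  one_mul _ := rfl
  mul_one _ := rfl
  inv_mul_cancel f := by
    ext t
    exact congrArg Subtype.val (f.toHomeomorph.apply_symm_apply t)

end PL0

/-- Dyadic rationals `a / 2^n`. -/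
def IsDyadic (t : ℝ) : Prop := ∃ (a : ℤ) (n : ℕ), t = a / 2 ^ n

theorem IsDyadic.zero : IsDyadic 0 := ⟨0, 0, by simp⟩

theorem IsDyadic.add {s t : ℝ} (hs : IsDyadic s) (ht : IsDyadic t) : IsDyadic (s + t) := by
  obtain ⟨a, n, rfl⟩ := hs
  obtain ⟨b, k, rfl⟩ := ht
  refine ⟨a * 2 ^ k + b * 2 ^ n, n + k, ?_⟩
  push_cast
  rw [pow_add]
  field_simp

theorem IsDyadic.neg {s : ℝ} (hs : IsDyadic s) : IsDyadic (-s) := by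
  obtain ⟨a, n, rfl⟩ := hs
  exact ⟨-a, n, by push_cast; ring⟩

theorem IsDyadic.zpow_mul {s : ℝ} (hs : IsDyadic s) (k : ℤ) : IsDyadic ((2 : ℝ) ^ k * s) := by
  obtain ⟨a, n, rfl⟩ := hs
  obtain ⟨j, rfl | rfl⟩ := k.eq_nat_or_neg
  · exact ⟨2 ^ j * a, n, by push_cast; rw [zpow_natCast]; ring⟩
  · refine ⟨a, n + j, ?_⟩
    rw [zpow_neg, zpow_natCast, pow_add]
    field_simp

theorem affine_on_gap (f : PL0) {s d : unitInterval} (hsd : s < d)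
    (h : ∀ t ∈ Ioo s d, ¬ IsBreak f t) :
    ∃ t m c, AffineNear f t m c ∧ (f d : ℝ) = f s + m * ((d : ℝ) - s) := by
  obtain ⟨t, ht⟩ := exists_between hsd
  obtain ⟨m, c, hmc⟩ := not_not.1 (h t ht)
  refine ⟨t, m, c, hmc, ?_⟩
  let u : Set unitInterval := {y | AffineNear f y m c}
  have hu : IsOpen u := isOpen_iff_mem_nhds.2 fun y hy => AffineNear.eventually hy
  have hord : (Ioo s d).OrdConnected := ordConnected_Ioo
  have hpre : IsPreconnected (Ioo s d) := isPreconnected_Ioo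
  have hsub : Ioo s d ⊆ u := by
    refine hpre.subset_of_closure_inter_subset hu ⟨t, ht, hmc⟩ ?_
    rintro y ⟨hyc, hy⟩
    obtain ⟨m', c', h'⟩ := not_not.1 (h y hy)
    obtain ⟨z, hz', hz⟩ := mem_closure_iff_nhds.1 hyc _ h'.eventually
    obtain ⟨rfl, rfl⟩ := AffineNear.unique hz hz'
    exact h'
  have hcl : IsClosed {y : unitInterval | (f y : ℝ) = m * y + c} :=
    isClosed_eq (continuous_subtype_val.comp f.toHomeomorph.continuous) (by fun_prop)
  have hIcc : Icc s d ⊆ {y : unitInterval | (f y : ℝ) = m * y + c} := by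
    rw [← closure_Ioo hsd.ne]
    exact closure_minimal (fun y hy => (hsub hy).self_of_nhds) hcl
  have h1 : (f s : ℝ) = m * s + c := hIcc (left_mem_Icc.2 hsd.le)
  have h2 : (f d : ℝ) = m * d + c := hIcc (right_mem_Icc.2 hsd.le)
  rw [h1, h2]
  ring

theorem PL0.map_zero (f : PL0) : f 0 = 0 := by
  have h := f.strictMono'.monotone (unitInterval.nonneg' (t := f.toHomeomorph.symm 0))
  rw [f.toHomeomorph.apply_symm_apply] at h
  exact le_antisymm h unitInterval.nonneg'

theorem isDyadic_apply_iff (f : PL0) (hb : ∀ x, IsBreak f x → IsDyadic x)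
    (hs : ∀ x m c, AffineNear f x m c → ∃ k : ℤ, m = 2 ^ k) (d : unitInterval) :
    IsDyadic (f d) ↔ IsDyadic d := by
  induction hn : ({x | IsBreak f x} ∩ Iio d).ncard using Nat.strong_induction_on
    generalizing d with
  | _ n ih =>
    rcases eq_or_lt_of_le (unitInterval.nonneg' (t := d)) with rfl | hd
    · rw [f.map_zero]
    have key : ∃ s < d, (∀ t ∈ Ioo s d, ¬ IsBreak f t) ∧ IsDyadic s ∧ IsDyadic (f s) := by
      have hfin : ({x | IsBreak f x} ∩ Iio d).Finite := f.finite_breaks'.inter_of_left _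
      rcases ({x | IsBreak f x} ∩ Iio d).eq_empty_or_nonempty with he | hne
      · refine ⟨0, hd, fun t ht hbt => ?_, by simpa using IsDyadic.zero, ?_⟩
        · exact (he ▸ (⟨hbt, ht.2⟩ : t ∈ {x | IsBreak f x} ∩ Iio d) : t ∈ (∅ : Set _))
        · rw [f.map_zero]; simpa using IsDyadic.zero
      · obtain ⟨s, ⟨hsb, hsd⟩, hmax⟩ := Set.exists_max_image _ id hfin hne
        refine ⟨s, hsd, fun t ht hbt => ?_, hb s hsb, ?_⟩
        · exact absurd (hmax t ⟨hbt, ht.2⟩) (not_le.2 ht.1)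
        · refine (ih _ ?_ s rfl).2 (hb s hsb)
          rw [← hn]
          refine Set.ncard_lt_ncard ⟨fun t ht => ⟨ht.1, lt_trans (mem_Iio.1 ht.2) hsd⟩, fun hcon => ?_⟩ hfin
          exact lt_irrefl s (hcon ⟨hsb, hsd⟩).2
    obtain ⟨s, hsd, hgap, hs1, hs2⟩ := key
    obtain ⟨t, m, c, hmc, heq⟩ := affine_on_gap f hsd hgap
    obtain ⟨k, rfl⟩ := hs _ _ _ hmc
    constructor
    · intro h
      have h3 : (d : ℝ) = s + 2 ^ (-k) * ((f d : ℝ) + -(f s : ℝ)) := by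
        rw [heq, zpow_neg]
        field_simp
        ring
      rw [h3]
      exact hs1.add ((h.add hs2.neg).zpow_mul _)
    · intro h
      rw [heq, sub_eq_add_neg]
      exact hs2.add ((h.add hs1.neg).zpow_mul _)

/-- Thompson's group `F`: the elements of `PL0` all of whose break points are dyadic rationals
and all of whose slopes are integral powers of `2`. -/
def F : Subgroup PL0 where
  carrier := {f | (∀ x, IsBreak f x → IsDyadic x) ∧
    ∀ x m c, AffineNear f x m c → ∃ k : ℤ, m = 2 ^ k}
  one_mem' := by
    refine ⟨fun x hx => (not_isBreak_refl x hx).elim, fun x m c h => ⟨0, ?_⟩⟩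
    have h1 : AffineNear (1 : PL0) x 1 0 := Eventually.of_forall fun y => by
      rw [PL0.one_apply]; ring
    simpa using (h.unique h1).1
  mul_mem' := by
    rintro f g ⟨hf, hf'⟩ ⟨hg, hg'⟩
    refine ⟨fun x hx => ?_, fun x m c h => ?_⟩
    · rcases isBreak_comp _ _ hx with h | h
      · exact hf x h
      · exact (isDyadic_apply_iff f hf hf' x).1 (hg _ h)
    · have hfin := f.finite_breaks'.union
        (g.finite_breaks'.preimage f.toHomeomorph.injective.injOn)
      obtain ⟨y, hy, hyb⟩ := ((infinite_of_mem_nhds x h.eventually).sdiff hfin).nonempty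
      simp only [mem_union, mem_preimage, mem_ofPred_eq, not_or, IsBreak, not_not] at hyb
      obtain ⟨⟨m1, c1, h1⟩, ⟨m2, c2, h2⟩⟩ := hyb
      obtain ⟨k1, rfl⟩ := hf' _ _ _ h1
      obtain ⟨k2, rfl⟩ := hg' _ _ _ h2
      have h3 := (AffineNear.unique hy (h1.comp f.toHomeomorph.continuous h2)).1
      exact ⟨k2 + k1, by rw [h3, zpow_add₀ two_ne_zero]⟩
  inv_mem' := by
    rintro f ⟨hf, hf'⟩
    refine ⟨fun x hx => ?_, fun x m c h => ?_⟩
    · have h1 := (isDyadic_apply_iff f hf hf' _).2 (hf _ (isBreak_symm _ hx))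
      rwa [f.toHomeomorph.apply_symm_apply] at h1
    · have hfin := f.finite_breaks'.preimage f.toHomeomorph.symm.injective.injOn
      obtain ⟨y, hy, hyb⟩ := ((infinite_of_mem_nhds x h.eventually).sdiff hfin).nonempty
      simp only [mem_preimage, mem_ofPred_eq, IsBreak, not_not] at hyb
      obtain ⟨m1, c1, h1⟩ := hyb
      obtain ⟨k1, rfl⟩ := hf' _ _ _ h1
      have h2 := h1.symm f.toHomeomorph
      rw [f.toHomeomorph.apply_symm_apply] at h2
      exact ⟨-k1, by rw [(AffineNear.unique hy h2).1, zpow_neg]⟩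

/-- A homeomorphism of `[0,1]` from mutually inverse strictly increasing formulas. -/
def mkHomeo (p q : ℝ → ℝ) (hp : ∀ t ∈ Icc (0 : ℝ) 1, p t ∈ Icc (0 : ℝ) 1)
    (hq : ∀ t ∈ Icc (0 : ℝ) 1, q t ∈ Icc (0 : ℝ) 1) (hqp : ∀ t ∈ Icc (0 : ℝ) 1, q (p t) = t)
    (hpq : ∀ t ∈ Icc (0 : ℝ) 1, p (q t) = t) (hle : ∀ s t : ℝ, p s ≤ p t ↔ s ≤ t) :
    unitInterval ≃ₜ unitInterval :=
  OrderIso.toHomeomorph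
    { toFun := fun t => ⟨p t, hp t t.2⟩
      invFun := fun t => ⟨q t, hq t t.2⟩
      left_inv := fun t => Subtype.ext (hqp t t.2)
      right_inv := fun t => Subtype.ext (hpq t t.2)
      map_rel_iff' := fun {s t} => hle s t }

theorem mkHomeo_strictMono (p q : ℝ → ℝ) (hp : ∀ t ∈ Icc (0 : ℝ) 1, p t ∈ Icc (0 : ℝ) 1)
    (hq : ∀ t ∈ Icc (0 : ℝ) 1, q t ∈ Icc (0 : ℝ) 1) (hqp : ∀ t ∈ Icc (0 : ℝ) 1, q (p t) = t)
    (hpq : ∀ t ∈ Icc (0 : ℝ) 1, p (q t) = t) (hle : ∀ s t : ℝ, p s ≤ p t ↔ s ≤ t) :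
    StrictMono (mkHomeo p q hp hq hqp hpq hle) :=
  fun s t hst => lt_of_not_ge fun h => not_le_of_gt hst ((hle t s).1 h)

/-- The formula of the standard generator `x₀`. -/
noncomputable def x0Fun (a : ℝ) : ℝ :=
  if a ≤ 1 / 4 then 2 * a else if a ≤ 1 / 2 then a + 1 / 4 else a / 2 + 1 / 2

/-- The formula of the standard generator `x₁`. -/
noncomputable def x1Fun (a : ℝ) : ℝ :=
  if a ≤ 1 / 2 then a
  else if a ≤ 5 / 8 then 2 * a - 1 / 2
  else if a ≤ 3 / 4 then a + 1 / 8 else a / 2 + 1 / 2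

/-- The formula of the inverse of `x₀`. -/
noncomputable def x0Inv (a : ℝ) : ℝ :=
  if a ≤ 1 / 2 then a / 2 else if a ≤ 3 / 4 then a - 1 / 4 else 2 * a - 1

/-- The formula of the inverse of `x₁`. -/
noncomputable def x1Inv (a : ℝ) : ℝ :=
  if a ≤ 1 / 2 then a
  else if a ≤ 3 / 4 then a / 2 + 1 / 4
  else if a ≤ 7 / 8 then a - 1 / 8 else 2 * a - 1

/-- The standard generator `x₀`. -/
noncomputable def x0 : PL0 where
  toHomeomorph := mkHomeo x0Fun x0Inv
    (by rintro t ⟨h0, h1⟩; unfold x0Fun; constructor <;> split_ifs <;> linarith)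
    (by rintro t ⟨h0, h1⟩; unfold x0Inv; constructor <;> split_ifs <;> linarith)
    (by rintro t ⟨h0, h1⟩; unfold x0Inv x0Fun; split_ifs <;> linarith)
    (by rintro t ⟨h0, h1⟩; unfold x0Inv x0Fun; split_ifs <;> linarith)
    (by intro s t; unfold x0Fun; constructor <;> split_ifs <;> intro h <;> linarith)
  strictMono' := mkHomeo_strictMono _ _ _ _ _ _ _
  finite_breaks' := by
    have hfin : (Subtype.val ⁻¹' ({1 / 4, 1 / 2} : Set ℝ) : Set unitInterval).Finite :=
      Set.Finite.preimage Subtype.val_injective.injOn (Set.toFinite ({1 / 4, 1 / 2} : Set ℝ))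
    refine hfin.subset fun x hx => ?_
    by_contra hcon
    simp only [mem_preimage, mem_insert_iff, mem_singleton_iff, not_or] at hcon
    obtain ⟨h1, h2⟩ := hcon
    have hc : Continuous ((↑) : unitInterval → ℝ) := continuous_subtype_val
    refine hx ?_
    rcases lt_or_gt_of_ne h1 with h1 | h1
    · refine ⟨2, 0, ?_⟩
      filter_upwards [hc.continuousAt.eventually_lt continuousAt_const h1] with y hy
      change x0Fun y = _
      unfold x0Fun
      split_ifs <;> linarith
    rcases lt_or_gt_of_ne h2 with h2 | h2
    · refine ⟨1, 1 / 4, ?_⟩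
      filter_upwards [continuousAt_const.eventually_lt hc.continuousAt h1,
        hc.continuousAt.eventually_lt continuousAt_const h2] with y hy hy'
      change x0Fun y = _
      unfold x0Fun
      split_ifs <;> linarith
    · refine ⟨1 / 2, 1 / 2, ?_⟩
      filter_upwards [continuousAt_const.eventually_lt hc.continuousAt h2] with y hy
      change x0Fun y = _
      unfold x0Fun
      split_ifs <;> linarith

theorem x1Fun_strictMono : StrictMono x1Fun := by
  intro s t h
  unfold x1Fun
  split_ifs <;> linarith

theorem x1_finite_breaks (f : unitInterval → unitInterval) (hf : ∀ y, (f y : ℝ) = x1Fun y) :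
    {x | IsBreak f x}.Finite := by
  have hfin : (Subtype.val ⁻¹' ({1 / 2, 5 / 8, 3 / 4} : Set ℝ) : Set unitInterval).Finite :=
    Set.Finite.preimage Subtype.val_injective.injOn
      (Set.toFinite ({1 / 2, 5 / 8, 3 / 4} : Set ℝ))
  refine hfin.subset fun x hx => ?_
  by_contra hcon
  simp only [mem_preimage, mem_insert_iff, mem_singleton_iff, not_or] at hcon
  obtain ⟨h1, h2, h3⟩ := hcon
  have hc : Continuous ((↑) : unitInterval → ℝ) := continuous_subtype_val
  refine hx ?_
  rcases lt_or_gt_of_ne h1 with h1 | h1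
  · refine ⟨1, 0, ?_⟩
    filter_upwards [hc.continuousAt.eventually_lt continuousAt_const h1] with y hy
    rw [hf y]
    unfold x1Fun
    split_ifs <;> linarith
  rcases lt_or_gt_of_ne h2 with h2 | h2
  · refine ⟨2, -(1 / 2), ?_⟩
    filter_upwards [continuousAt_const.eventually_lt hc.continuousAt h1,
      hc.continuousAt.eventually_lt continuousAt_const h2] with y hy hy'
    rw [hf y]
    unfold x1Fun
    split_ifs <;> linarith
  rcases lt_or_gt_of_ne h3 with h3 | h3
  · refine ⟨1, 1 / 8, ?_⟩
    filter_upwards [continuousAt_const.eventually_lt hc.continuousAt h2,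
      hc.continuousAt.eventually_lt continuousAt_const h3] with y hy hy'
    rw [hf y]
    unfold x1Fun
    split_ifs <;> linarith
  · refine ⟨1 / 2, 1 / 2, ?_⟩
    filter_upwards [continuousAt_const.eventually_lt hc.continuousAt h3] with y hy
    rw [hf y]
    unfold x1Fun
    split_ifs <;> linarith

/-- The standard generator `x₁`. -/
noncomputable def x1 : PL0 where
  toHomeomorph := mkHomeo x1Fun x1Inv
    (by rintro t ⟨h0, h1⟩; unfold x1Fun; constructor <;> split_ifs <;> linarith)
    (by rintro t ⟨h0, h1⟩; unfold x1Inv; constructor <;> split_ifs <;> linarith)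
    (by rintro t ⟨h0, h1⟩; unfold x1Inv x1Fun; split_ifs <;> linarith)
    (by rintro t ⟨h0, h1⟩; unfold x1Inv x1Fun; split_ifs <;> linarith)
    (fun _ _ => x1Fun_strictMono.le_iff_le)
  strictMono' := mkHomeo_strictMono _ _ _ _ _ _ _
  finite_breaks' := x1_finite_breaks _ fun _ => rfl

/-- The sequence `x₀, x₁, x₂, …` with `x_{k+1} = x₁ ^ (x₀^k)`, where `a ^ b = b⁻¹ a b`. -/
noncomputable def x : ℕ → PL0
  | 0 => x0
  | k + 1 => (x0 ^ k)⁻¹ * x1 * x0 ^ k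

/-- The support of a subgroup: the points moved by some element. -/
def Supp (H : Subgroup PL0) : Set unitInterval := {t | ∃ h ∈ H, h t ≠ t}

/-- The orbitals of `H` are the connected components of its support. -/
def IsOrbital (H : Subgroup PL0) (W : Set unitInterval) : Prop :=
  ∃ t ∈ Supp H, W = connectedComponentIn (Supp H) t

/-- `h|_W` moves points near `e` (an end point of `W`): there are points of `W` arbitrarily close
to `e` that are moved by `h`. The negation says that `h` is the identity on `W` near `e`. -/
def MovesPointsNear (h : PL0) (W : Set unitInterval) (e : unitInterval) : Prop :=
  ∃ᶠ t in 𝓝[W] e, h t ≠ t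

end ThompsonPL

/-! Transport by `s ↦ 1/2 + s/4` turns `x₀`, `x₁` into `f₀`, `f₁`: these act on `[1/2, 3/4]` as
scaled copies and are the identity elsewhere (`isCopy_x0`, `isCopy_x1`). Hence `⟨f₀, f₁⟩ ≅ ⟨x₀, x₁⟩`
(`nonempty_mulEquiv_of_isCopy`).

That `⟨x₀, x₁⟩` is all of `F` (`genSubgroup_eq_F`) is shown with tree pairs. Every element of `F`
carries the leaves of one dyadic subdivision affinely onto those of another
(`exists_treePair_of_mem_F`). Since `x₀` and `x₁` act on subdivisions as tree rotations, products of
them and their inverses bring any tree to the left vine of the same size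
(`exists_treePair_leftVine`), and a tree pair determines its element.

Because `f₀` and `f₁` are trivial near `0` and `1`, every `h ∈ H` agrees near both ends with the
same power `x₀ ^ n` (`exists_zpow_of_mem_extendedSubgroup`). For `n ≠ 0` this power moves every
point of `(0, 1)`, so `h` moves points near one end exactly when it does near the other. As `x₀`
alone already has support `(0, 1)`, that is the only orbital, and `H` refutes the converse. -/

namespace ThompsonPL

open Set Filter Topology

/-! ### Dyadic subdivisions and tree pairs. -/

/-- Finite binary trees, encoding subdivisions of an interval by repeated halving. -/
inductive DyadicTree where
  | leaf : DyadicTree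
  | node : DyadicTree → DyadicTree → DyadicTree

namespace DyadicTree

/-- The intervals `[a, a + w]`, encoded as pairs `(a, w)`, of the subdivision of `[a, a + w]`
given by a tree. -/
noncomputable def leaves : DyadicTree → ℝ → ℝ → List (ℝ × ℝ)
  | leaf, a, w => [(a, w)]
  | node l r, a, w => leaves l a (w / 2) ++ leaves r (a + w / 2) (w / 2)

/-- The number of leaves. -/
def size : DyadicTree → ℕ
  | leaf => 1
  | node l r => size l + size r

theorem length_leaves (T : DyadicTree) (a w : ℝ) : (T.leaves a w).length = T.size := by
  induction T generalizing a w with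
  | leaf => rfl
  | node l r hl hr => simp [leaves, size, hl, hr]

theorem size_pos (T : DyadicTree) : 0 < T.size := by
  induction T with
  | leaf => exact Nat.one_pos
  | node l r hl hr => exact Nat.add_pos_left hl _

/-- The left vine with `n + 1` leaves. -/
def leftVine : ℕ → DyadicTree
  | 0 => leaf
  | n + 1 => node (leftVine n) leaf

theorem size_leftVine (n : ℕ) : (leftVine n).size = n + 1 := by
  induction n with
  | zero => rfl
  | succ n ih => simp [leftVine, size, ih]

/-- The complete tree of depth `n`. -/
def full : ℕ → DyadicTree
  | 0 => leaf
  | n + 1 => node (full n) (full n)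

theorem exists_mem_leaves (T : DyadicTree) {a w y : ℝ} (hw : 0 < w) (h1 : a ≤ y) (h2 : y ≤ a + w) :
    ∃ p ∈ T.leaves a w, ∃ s ∈ Icc (0 : ℝ) 1, y = p.1 + s * p.2 := by
  induction T generalizing a w with
  | leaf =>
    refine ⟨(a, w), by simp [leaves], (y - a) / w, ⟨?_, ?_⟩, ?_⟩
    · exact div_nonneg (by linarith) hw.le
    · rw [div_le_one hw]; linarith
    · field_simp; ring
  | node l r hl hr =>
    rcases le_total y (a + w / 2) with h | h
    · obtain ⟨p, hp, q⟩ := hl (half_pos hw) h1 h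
      exact ⟨p, List.mem_append_left _ hp, q⟩
    · obtain ⟨p, hp, q⟩ := hr (half_pos hw) h (by linarith)
      exact ⟨p, List.mem_append_right _ hp, q⟩

end DyadicTree

open DyadicTree

/-- `f` maps `[p.1, p.1 + p.2]` affinely onto `[q.1, q.1 + q.2]`. -/
def AffineOnto (f : PL0) (p q : ℝ × ℝ) : Prop :=
  ∀ s ∈ Icc (0 : ℝ) 1, ∀ y : unitInterval, (y : ℝ) = p.1 + s * p.2 → (f y : ℝ) = q.1 + s * q.2

theorem AffineOnto.mul {f g : PL0} {p q r : ℝ × ℝ} (hf : AffineOnto f p q)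
    (hg : AffineOnto g q r) : AffineOnto (f * g) p r :=
  fun s hs y hy => hg s hs (f y) (hf s hs y hy)

/-- Affine maps preserve midpoints, so the same tree may be grafted onto an interval and onto its
image. -/
theorem AffineOnto.leaves {f : PL0} {a w c v : ℝ} (h : AffineOnto f (a, w) (c, v))
    (T : DyadicTree) : List.Forall₂ (AffineOnto f) (T.leaves a w) (T.leaves c v) := by
  induction T generalizing a w c v with
  | leaf => exact List.Forall₂.cons h List.Forall₂.nil
  | node l r hl hr =>
    refine List.rel_append (hl ?_) (hr ?_)
    · rintro s ⟨h0, h1⟩ y hy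
      have := h (s / 2) ⟨by linarith, by linarith⟩ y (by rw [hy]; ring)
      rw [this]; ring
    · rintro s ⟨h0, h1⟩ y hy
      have := h ((1 + s) / 2) ⟨by linarith, by linarith⟩ y (by rw [hy]; ring)
      rw [this]; ring

/-- `f` maps the leaves of the subdivision `S` affinely onto the leaves of the subdivision `T`. -/
def TreePair (f : PL0) (S T : DyadicTree) : Prop :=
  List.Forall₂ (AffineOnto f) (S.leaves 0 1) (T.leaves 0 1)

theorem TreePair.size_eq {f : PL0} {S T : DyadicTree} (h : TreePair f S T) : S.size = T.size := by
  rw [← length_leaves S 0 1, ← length_leaves T 0 1, List.Forall₂.length_eq h]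

theorem forall₂_comp {α : Type*} {R R' R'' : α → α → Prop}
    (h : ∀ a b c, R a b → R' b c → R'' a c) {l₁ l₂ l₃ : List α}
    (h₁ : List.Forall₂ R l₁ l₂) (h₂ : List.Forall₂ R' l₂ l₃) : List.Forall₂ R'' l₁ l₃ := by
  induction h₁ generalizing l₃ with
  | nil => cases h₂; exact List.Forall₂.nil
  | cons hab _ ih =>
    cases h₂ with
    | cons hbc h' => exact List.Forall₂.cons (h _ _ _ hab hbc) (ih h')

theorem forall₂_exists {α β : Type*} {R R' : α → β → Prop} {l₁ : List α} {l₂ : List β}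
    (h₁ : List.Forall₂ R l₁ l₂) (h₂ : List.Forall₂ R' l₁ l₂) {a : α} (ha : a ∈ l₁) :
    ∃ b, R a b ∧ R' a b := by
  induction h₁ with
  | nil => simp at ha
  | cons hab _ ih =>
    cases h₂ with
    | cons hbc h =>
      rcases List.mem_cons.1 ha with rfl | ha
      · exact ⟨_, hab, hbc⟩
      · exact ih h ha

theorem TreePair.mul {f g : PL0} {S T U : DyadicTree} (hf : TreePair f S T)
    (hg : TreePair g T U) : TreePair (f * g) S U :=
  forall₂_comp (R := AffineOnto f) (R' := AffineOnto g) (R'' := AffineOnto (f * g))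
    (fun _ _ _ h h' => h.mul h') hf hg

/-- The leaves of `S` cover `[0, 1]`, and on each of them the matching leaf of `T` prescribes the
map. -/
theorem TreePair.unique {f g : PL0} {S T : DyadicTree} (hf : TreePair f S T)
    (hg : TreePair g S T) : f = g := by
  ext t
  obtain ⟨p, hp, s, hs, ht⟩ := S.exists_mem_leaves one_pos t.2.1 (by simpa using t.2.2)
  obtain ⟨q, h1, h2⟩ := forall₂_exists hf hg hp
  rw [h1 s hs t ht, h2 s hs t ht]

theorem treePair_one (T : DyadicTree) : TreePair 1 T T :=
  AffineOnto.leaves (fun _ _ _ hy => hy) T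

theorem x0_affineOnto :
    AffineOnto x0 (0, 1 / 4) (0, 1 / 2) ∧ AffineOnto x0 (1 / 4, 1 / 4) (1 / 2, 1 / 4) ∧
      AffineOnto x0 (1 / 2, 1 / 2) (3 / 4, 1 / 4) := by
  refine ⟨?_, ?_, ?_⟩ <;>
  · rintro s ⟨h0, h1⟩ y hy
    change x0Fun y = _
    simp only at hy
    unfold x0Fun
    split_ifs <;> linarith

theorem x0_inv_affineOnto :
    AffineOnto x0⁻¹ (0, 1 / 2) (0, 1 / 4) ∧ AffineOnto x0⁻¹ (1 / 2, 1 / 4) (1 / 4, 1 / 4) ∧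
      AffineOnto x0⁻¹ (3 / 4, 1 / 4) (1 / 2, 1 / 2) := by
  refine ⟨?_, ?_, ?_⟩ <;>
  · rintro s ⟨h0, h1⟩ y hy
    change x0Inv y = _
    simp only at hy
    unfold x0Inv
    split_ifs <;> linarith

theorem x1_affineOnto :
    AffineOnto x1 (0, 1 / 2) (0, 1 / 2) ∧ AffineOnto x1 (1 / 2, 1 / 8) (1 / 2, 1 / 4) ∧
      AffineOnto x1 (5 / 8, 1 / 8) (3 / 4, 1 / 8) ∧
      AffineOnto x1 (3 / 4, 1 / 4) (7 / 8, 1 / 8) := by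
  refine ⟨?_, ?_, ?_, ?_⟩ <;>
  · rintro s ⟨h0, h1⟩ y hy
    change x1Fun y = _
    simp only at hy
    unfold x1Fun
    split_ifs <;> linarith

/-- `x0` is the rotation at the root. The subtrees are arbitrary because each of its three affine
pieces accepts a graft. -/
theorem x0_treePair (A B C : DyadicTree) :
    TreePair x0 (node (node A B) C) (node A (node B C)) := by
  obtain ⟨h1, h2, h3⟩ := x0_affineOnto
  have := List.rel_append (h1.leaves A) (List.rel_append (h2.leaves B) (h3.leaves C))
  unfold TreePair
  simp only [DyadicTree.leaves, List.append_assoc]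
  convert this using 3 <;> norm_num

theorem x0_inv_treePair (A B C : DyadicTree) :
    TreePair x0⁻¹ (node A (node B C)) (node (node A B) C) := by
  obtain ⟨h1, h2, h3⟩ := x0_inv_affineOnto
  have := List.rel_append (h1.leaves A) (List.rel_append (h2.leaves B) (h3.leaves C))
  unfold TreePair
  simp only [DyadicTree.leaves, List.append_assoc]
  convert this using 3 <;> norm_num

/-- `x1` is the same rotation, performed at the right child of the root. -/
theorem x1_treePair (A B C D : DyadicTree) :
    TreePair x1 (node A (node (node B C) D)) (node A (node B (node C D))) := by
  obtain ⟨h1, h2, h3, h4⟩ := x1_affineOnto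
  have := List.rel_append (h1.leaves A)
    (List.rel_append (h2.leaves B) (List.rel_append (h3.leaves C) (h4.leaves D)))
  unfold TreePair
  simp only [DyadicTree.leaves, List.append_assoc]
  convert this using 3 <;> norm_num

/-! ### Rotating every tree to a left vine. -/

/-- The subgroup generated by `x₀` and `x₁`. -/
def genSubgroup : Subgroup PL0 := Subgroup.closure {x0, x1}

theorem x0_mem_genSubgroup : x0 ∈ genSubgroup := Subgroup.subset_closure (by simp)

theorem x1_mem_genSubgroup : x1 ∈ genSubgroup := Subgroup.subset_closure (by simp)

/-- Each rotation at the root replaces the left subtree by its own left subtree, so repetition ends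
at a leaf. -/
theorem exists_treePair_node_leaf (L R : DyadicTree) :
    ∃ g ∈ genSubgroup, ∃ T, TreePair g (node L R) (node leaf T) := by
  induction hn : L.size using Nat.strong_induction_on generalizing L R with
  | _ n ih =>
    cases L with
    | leaf => exact ⟨1, one_mem _, R, treePair_one _⟩
    | node A B =>
      obtain ⟨g, hg, T, hT⟩ := ih A.size (by rw [← hn, size]; have := B.size_pos; omega) A
        (node B R) rfl
      exact ⟨x0 * g, mul_mem x0_mem_genSubgroup hg, T, (x0_treePair A B R).mul hT⟩

theorem exists_treePair_node_node_leaf (A L R : DyadicTree) :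
    ∃ g ∈ genSubgroup, ∃ T, TreePair g (node A (node L R)) (node A (node leaf T)) := by
  induction hn : L.size using Nat.strong_induction_on generalizing L R with
  | _ n ih =>
    cases L with
    | leaf => exact ⟨1, one_mem _, R, treePair_one _⟩
    | node B C =>
      obtain ⟨g, hg, T, hT⟩ := ih B.size (by rw [← hn, size]; have := C.size_pos; omega) B
        (node C R) rfl
      exact ⟨x1 * g, mul_mem x1_mem_genSubgroup hg, T, (x1_treePair A B C R).mul hT⟩

/-- Rotations by `x1` reduce the left part of the right subtree to a single leaf. Then `x0⁻¹` moves
this leaf onto the vine, which grows by one. -/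
theorem exists_treePair_leftVine_of_node (k : ℕ) (R : DyadicTree) :
    ∃ g ∈ genSubgroup, ∃ n, TreePair g (node (leftVine k) R) (leftVine n) := by
  induction hn : R.size using Nat.strong_induction_on generalizing k R with
  | _ n ih =>
    cases R with
    | leaf => exact ⟨1, one_mem _, k + 1, treePair_one _⟩
    | node B C =>
      obtain ⟨g, hg, T, hT⟩ := exists_treePair_node_node_leaf (leftVine k) B C
      -- A tree pair preserves the number of leaves, so `T` has one leaf fewer than the right
      -- subtree and the induction descends.
      have hsize := hT.size_eq
      simp only [size] at hsize hn
      obtain ⟨g', hg', m, hm⟩ := ih T.size (by omega) (k + 1) T rfl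
      exact ⟨g * (x0⁻¹ * g'), mul_mem hg (mul_mem (inv_mem x0_mem_genSubgroup) hg'), m,
        hT.mul ((x0_inv_treePair _ _ _).mul hm)⟩

theorem exists_treePair_leftVine (T : DyadicTree) :
    ∃ g ∈ genSubgroup, TreePair g T (leftVine (T.size - 1)) := by
  have : ∃ g ∈ genSubgroup, ∃ n, TreePair g T (leftVine n) := by
    cases T with
    | leaf => exact ⟨1, one_mem _, 0, treePair_one _⟩
    | node L R =>
      obtain ⟨g, hg, U, hU⟩ := exists_treePair_node_leaf L R
      obtain ⟨g', hg', m, hm⟩ := exists_treePair_leftVine_of_node 0 U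
      exact ⟨g * g', mul_mem hg hg', m, hU.mul hm⟩
  obtain ⟨g, hg, n, hn⟩ := this
  have := hn.size_eq
  rw [size_leftVine] at this
  exact ⟨g, hg, by rwa [this]⟩

/-- `S` and `T` have equally many leaves and so reach the same vine; uniqueness then expresses `f`
through the two reductions. -/
theorem TreePair.mem_genSubgroup {f : PL0} {S T : DyadicTree} (h : TreePair f S T) :
    f ∈ genSubgroup := by
  obtain ⟨g, hg, hgS⟩ := exists_treePair_leftVine S
  obtain ⟨g', hg', hgT⟩ := exists_treePair_leftVine T
  rw [h.size_eq] at hgS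
  rw [eq_mul_inv_of_mul_eq ((h.mul hgT).unique hgS)]
  exact mul_mem hg (inv_mem hg')

/-! ### Elements of `F` come from tree pairs. -/

/-- The consecutive intervals `[i / 2^M, (i + 1) / 2^M]` for `p ≤ i < p + q`. -/
noncomputable def uniformIntervals (M p q : ℕ) : List (ℝ × ℝ) :=
  (List.range' p q).map fun i : ℕ => ((i : ℝ) / 2 ^ M, 1 / 2 ^ M)

theorem uniformIntervals_add (M p q r : ℕ) :
    uniformIntervals M p (q + r) = uniformIntervals M p q ++ uniformIntervals M (p + q) r := by
  rw [uniformIntervals, ← List.range'_append_1, List.map_append]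
  rfl

theorem leaves_full (M e p : ℕ) :
    (full e).leaves ((p : ℝ) / 2 ^ M) (2 ^ e / 2 ^ M) = uniformIntervals M p (2 ^ e) := by
  induction e generalizing p with
  | zero => simp [full, leaves, uniformIntervals]
  | succ e ih =>
    have h1 : (2 : ℝ) ^ (e + 1) / 2 ^ M / 2 = 2 ^ e / 2 ^ M := by ring
    have h2 : (p : ℝ) / 2 ^ M + 2 ^ e / 2 ^ M = ((p + 2 ^ e : ℕ) : ℝ) / 2 ^ M := by
      push_cast; ring
    rw [full, leaves, h1, h2, ih, ih, pow_succ, mul_two, uniformIntervals_add]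

theorem IsDyadic.eventually {t : ℝ} (h : IsDyadic t) : ∀ᶠ N : ℕ in atTop, ∃ i : ℤ, t = i / 2 ^ N := by
  obtain ⟨a, n, rfl⟩ := h
  filter_upwards [eventually_ge_atTop n] with N hN
  obtain ⟨k, rfl⟩ := Nat.exists_eq_add_of_le hN
  refine ⟨a * 2 ^ k, ?_⟩
  push_cast
  rw [pow_add]
  field_simp

theorem exists_common_denominator {A : Set unitInterval} (hA : A.Finite)
    (h : ∀ t ∈ A, IsDyadic t) : ∃ N : ℕ, ∀ t ∈ A, ∃ i : ℕ, (t : ℝ) = i / 2 ^ N := by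
  obtain ⟨N, hN⟩ := ((eventually_all_finite hA).2 fun t ht => (h t ht).eventually).exists
  refine ⟨N, fun t ht => ?_⟩
  obtain ⟨i, hi⟩ := hN t ht
  have : (0 : ℝ) ≤ i := by
    have := t.2.1
    rw [hi] at this
    by_contra hneg
    exact absurd this (not_le.2 (div_neg_of_neg_of_pos (not_le.1 hneg) (by positivity)))
  lift i to ℕ using (by exact_mod_cast this)
  exact ⟨i, by simpa using hi⟩

/-- The points of the gap sharing one affine germ form an open and relatively closed set, hence the
whole gap. Unlike `affine_on_gap`, this keeps the formula at every point of the closed interval. -/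
theorem exists_affine_on_Icc_of_gap (f : PL0) {s d : unitInterval} (hsd : s < d)
    (h : ∀ t ∈ Ioo s d, ¬ IsBreak f t) :
    ∃ t m c, AffineNear f t m c ∧ ∀ y ∈ Icc s d, (f y : ℝ) = m * y + c := by
  obtain ⟨t, ht⟩ := exists_between hsd
  obtain ⟨m, c, hmc⟩ := not_not.1 (h t ht)
  refine ⟨t, m, c, hmc, ?_⟩
  have hu : IsOpen {y | AffineNear f y m c} :=
    isOpen_iff_mem_nhds.2 fun y hy => AffineNear.eventually hy
  have hsub : Ioo s d ⊆ {y | AffineNear f y m c} := by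
    refine isPreconnected_Ioo.subset_of_closure_inter_subset hu ⟨t, ht, hmc⟩ ?_
    rintro y ⟨hyc, hy⟩
    obtain ⟨m', c', h'⟩ := not_not.1 (h y hy)
    obtain ⟨z, hz', hz⟩ := mem_closure_iff_nhds.1 hyc _ h'.eventually
    obtain ⟨rfl, rfl⟩ := AffineNear.unique hz hz'
    exact h'
  have hcl : IsClosed {y : unitInterval | (f y : ℝ) = m * y + c} :=
    isClosed_eq (continuous_subtype_val.comp f.toHomeomorph.continuous) (by fun_prop)
  intro y hy
  rw [← closure_Ioo hsd.ne] at hy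
  exact closure_minimal (fun y hy => (hsub hy).self_of_nhds) hcl hy

theorem PL0.map_one (f : PL0) : f 1 = 1 := by
  have h := f.strictMono'.monotone (unitInterval.le_one' (t := f.toHomeomorph.symm 1))
  rw [f.toHomeomorph.apply_symm_apply] at h
  exact le_antisymm unitInterval.le_one' h

/-- The image has length `(P - p) / 2 ^ M`, which is also a power of `2`. So `P - p = 2 ^ e`, and
the complete tree of depth `e` cuts the source into pieces matching the uniform intervals of the
image. -/
theorem exists_leaves_of_affine {f : PL0} {N M p P : ℕ} {k : ℤ} {c : ℝ} {s d : unitInterval}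
    (hsd : (d : ℝ) = s + 1 / 2 ^ N) (h : ∀ y ∈ Icc s d, (f y : ℝ) = 2 ^ k * y + c)
    (hs : (f s : ℝ) = p / 2 ^ M) (hd : (f d : ℝ) = P / 2 ^ M) :
    ∃ S : DyadicTree, ∃ q, P = p + q ∧
      List.Forall₂ (AffineOnto f) (S.leaves s (1 / 2 ^ N)) (uniformIntervals M p q) := by
  have hle : s ≤ d := by
    rw [← Subtype.coe_le_coe, hsd]
    have : (0 : ℝ) < 1 / 2 ^ N := by positivity
    linarith
  have h1 := h s (left_mem_Icc.2 hle)
  have h2 := h d (right_mem_Icc.2 hle)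
  have h3 : (P : ℝ) - p = 2 ^ (k - N + M) := by
    have : (P : ℝ) / 2 ^ M - p / 2 ^ M = 2 ^ k * (1 / 2 ^ N) := by
      rw [← hs, ← hd, h1, h2, hsd]; ring
    rw [zpow_add₀ two_ne_zero, zpow_sub₀ two_ne_zero, zpow_natCast, zpow_natCast]
    field_simp at this ⊢
    linarith
  have h4 : p < P := by
    have : (0 : ℝ) < P - p := by rw [h3]; positivity
    exact_mod_cast sub_pos.1 this
  -- The exponent cannot be negative because `P - p` is a positive integer.
  have h5 : 0 ≤ k - N + M := by
    have : (1 : ℝ) ≤ 2 ^ (k - N + M) := by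
      rw [← h3, le_sub_iff_add_le']
      exact_mod_cast h4
    exact (one_le_zpow_iff_right₀ one_lt_two).1 this
  obtain ⟨e, he⟩ := Int.eq_ofNat_of_zero_le h5
  rw [he, zpow_natCast] at h3
  have h6 : (2 : ℝ) ^ e / 2 ^ M = 2 ^ k * (1 / 2 ^ N) := by
    rw [← h3, sub_div, ← hs, ← hd, h1, h2, hsd]; ring
  refine ⟨full e, 2 ^ e, ?_, ?_⟩
  · rw [sub_eq_iff_eq_add'] at h3
    exact_mod_cast h3
  · rw [← leaves_full]
    refine AffineOnto.leaves ?_ _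
    rintro u ⟨hu0, hu1⟩ y hy
    simp only at hy ⊢
    have hw : (0 : ℝ) < 1 / 2 ^ N := by positivity
    have hmem : y ∈ Icc s d := by
      constructor
      · rw [← Subtype.coe_le_coe, hy]
        have := mul_nonneg hu0 hw.le
        linarith
      · rw [← Subtype.coe_le_coe, hy, hsd]
        have := mul_le_mul_of_nonneg_right hu1 hw.le
        linarith
    rw [h y hmem, h6, ← hs, h1, hy]
    ring

theorem exists_treePair_of_mem_F {f : PL0} (hf : f ∈ F) : ∃ S T, TreePair f S T := by
  obtain ⟨hb, hsl⟩ := hf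
  obtain ⟨N, hN⟩ := exists_common_denominator f.finite_breaks' fun t ht => hb t ht
  have hpos : (0 : ℝ) < 2 ^ N := by positivity
  -- All break points lie on the grid of mesh `2 ^ (-N)`; `M` is chosen so that the images of grid
  -- points lie on the grid of mesh `2 ^ (-M)`.
  obtain ⟨M, hM⟩ : ∃ M : ℕ, ∀ y : unitInterval, (∃ j : ℕ, (y : ℝ) = j / 2 ^ N) →
      ∃ p : ℕ, (f y : ℝ) = p / 2 ^ M := by
    have hfin : {y : unitInterval | ∃ j : ℕ, (y : ℝ) = j / 2 ^ N}.Finite := by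
      refine Set.Finite.preimage (f := ((↑) : unitInterval → ℝ))
        (s := {t | ∃ j : ℕ, t = j / 2 ^ N ∧ t ≤ 1}) Subtype.val_injective.injOn ?_ |>.subset ?_
      · refine ((Set.finite_Iic (2 ^ N)).image fun j : ℕ => (j : ℝ) / 2 ^ N).subset ?_
        rintro _ ⟨j, rfl, hj⟩
        rw [div_le_one hpos] at hj
        exact ⟨j, by exact_mod_cast hj, rfl⟩
      · rintro y ⟨j, hj⟩
        exact ⟨j, hj, y.2.2⟩
    obtain ⟨M, hM⟩ := exists_common_denominator (hfin.image f) (by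
      rintro _ ⟨y, ⟨j, hj⟩, rfl⟩
      exact (isDyadic_apply_iff f hb hsl y).2 ⟨j, N, by simpa using hj⟩)
    exact ⟨M, fun y hy => hM _ ⟨y, hy, rfl⟩⟩
  -- The image of a dyadic interval need not be a node of a subdivision, so the target is recorded
  -- as a run of uniform intervals. Only for the whole of `[0, 1]` does this run become the leaves
  -- of `full M`.
  have key : ∀ e j : ℕ, ∀ s d : unitInterval, (s : ℝ) = j / 2 ^ N →
      (d : ℝ) = s + 2 ^ e / 2 ^ N → ∀ p P : ℕ, (f s : ℝ) = p / 2 ^ M → (f d : ℝ) = P / 2 ^ M →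
      ∃ S : DyadicTree, ∃ q, P = p + q ∧
        List.Forall₂ (AffineOnto f) (S.leaves s (2 ^ e / 2 ^ N)) (uniformIntervals M p q) := by
    intro e
    induction e with
    | zero =>
      intro j s d hs hd p P hp hP
      rw [pow_zero] at hd ⊢
      have hlt : s < d := by
        rw [← Subtype.coe_lt_coe, hd]
        have : (0 : ℝ) < 1 / 2 ^ N := by positivity
        linarith
      -- A break point strictly inside a grid cell would have its numerator strictly between `j` and
      -- `j + 1`.
      obtain ⟨t, m, c, htm, haff⟩ := exists_affine_on_Icc_of_gap f hlt fun t ht hbt => by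
        obtain ⟨i, hi⟩ := hN t hbt
        have h1 : (s : ℝ) < t := ht.1
        have h2 : (t : ℝ) < d := ht.2
        rw [hi] at h1 h2
        rw [hd, hs, ← add_div] at h2
        rw [hs] at h1
        rw [div_lt_div_iff_of_pos_right hpos] at h1 h2
        have h1' : j < i := by exact_mod_cast h1
        have h2' : i < j + 1 := by exact_mod_cast h2
        omega
      obtain ⟨k, rfl⟩ := hsl _ _ _ htm
      exact exists_leaves_of_affine hd haff hp hP
    | succ e ih =>
      intro j s d hs hd p P hp hP
      have hw : (0 : ℝ) < 2 ^ e / 2 ^ N := by positivity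
      have hhalf : (2 : ℝ) ^ (e + 1) / 2 ^ N / 2 = 2 ^ e / 2 ^ N := by ring
      have hd' : (d : ℝ) = s + 2 ^ e / 2 ^ N + 2 ^ e / 2 ^ N := by rw [hd]; ring
      let m : unitInterval := ⟨s + 2 ^ e / 2 ^ N, by
        have := s.2.1
        have := d.2.2
        constructor <;> linarith⟩
      have hm : (m : ℝ) = s + 2 ^ e / 2 ^ N := rfl
      have hmj : (m : ℝ) = (j + 2 ^ e : ℕ) / 2 ^ N := by rw [hm, hs]; push_cast; ring
      obtain ⟨Q, hQ⟩ := hM m ⟨_, hmj⟩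
      obtain ⟨S, q, hq, hS⟩ := ih j s m hs hm p Q hp hQ
      obtain ⟨S', q', hq', hS'⟩ := ih _ m d hmj (by rw [hd', hm]) Q P hQ hP
      refine ⟨node S S', q + q', by omega, ?_⟩
      rw [uniformIntervals_add, leaves, hhalf, ← hm, ← hq]
      exact List.rel_append hS hS'
  obtain ⟨S, q, hq, hS⟩ := key N 0 0 1 (by simp) (by simp [hpos.ne']) 0 (2 ^ M)
    (by rw [f.map_zero]; simp) (by rw [f.map_one]; simp)
  rw [zero_add] at hq
  subst hq
  refine ⟨S, full M, ?_⟩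
  have := leaves_full M M 0
  rw [← this] at hS
  simpa [TreePair] using hS

theorem F_le_genSubgroup : F ≤ genSubgroup := fun _ hf => by
  obtain ⟨S, T, h⟩ := exists_treePair_of_mem_F hf
  exact h.mem_genSubgroup

/-! ### The generators lie in `F`. -/

theorem mem_F_of_forall_notMem {f : PL0} (A : Set ℝ) (hA : A.Finite) (hd : ∀ t ∈ A, IsDyadic t)
    (h : ∀ x : unitInterval, (x : ℝ) ∉ A → ∃ k : ℤ, ∃ c, AffineNear f x (2 ^ k) c) : f ∈ F := by
  refine ⟨fun x hx => ?_, fun x m c hm => ?_⟩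
  · by_contra hcon
    obtain ⟨k, c, hk⟩ := h x fun hxA => hcon (hd _ hxA)
    exact hx ⟨_, _, hk⟩
  -- An affine germ persists on a neighbourhood, which is infinite and so contains a point outside
  -- `A` with the same slope.
  · have hfin : (Subtype.val ⁻¹' A : Set unitInterval).Finite :=
      hA.preimage Subtype.val_injective.injOn
    obtain ⟨y, hy, hyA⟩ := ((infinite_of_mem_nhds x hm.eventually).sdiff hfin).nonempty
    obtain ⟨k, c', hk⟩ := h y hyA
    exact ⟨k, (AffineNear.unique hy hk).1⟩

theorem affineNear_of_forall_Ioo {f : unitInterval → unitInterval} {x : unitInterval} {m c a b : ℝ}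
    (ha : a < x) (hb : x < b) (h : ∀ y : unitInterval, a < y → y < b → (f y : ℝ) = m * y + c) :
    AffineNear f x m c := by
  have hc : Continuous ((↑) : unitInterval → ℝ) := continuous_subtype_val
  filter_upwards [continuousAt_const.eventually_lt hc.continuousAt ha,
    hc.continuousAt.eventually_lt continuousAt_const hb] with y using h y

theorem x0_mem_F : x0 ∈ F := by
  refine mem_F_of_forall_notMem {1 / 4, 1 / 2} (Set.toFinite _) ?_ fun x hx => ?_
  · rintro t (rfl | rfl)
    · exact ⟨1, 2, by norm_num⟩
    · exact ⟨1, 1, by norm_num⟩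
  · simp only [mem_insert_iff, mem_singleton_iff, not_or] at hx
    obtain ⟨h0, h1⟩ := x.2
    rcases lt_or_gt_of_ne hx.1 with h2 | h2
    · refine ⟨1, 0, affineNear_of_forall_Ioo (a := -1) (by linarith) h2 fun y _ _ => ?_⟩
      change x0Fun y = _
      unfold x0Fun
      rw [zpow_one]
      split_ifs <;> linarith
    rcases lt_or_gt_of_ne hx.2 with h3 | h3
    · refine ⟨0, 1 / 4, affineNear_of_forall_Ioo h2 h3 fun y _ _ => ?_⟩
      change x0Fun y = _
      unfold x0Fun
      rw [zpow_zero]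
      split_ifs <;> linarith
    · refine ⟨-1, 1 / 2, affineNear_of_forall_Ioo (b := 2) h3 (by linarith) fun y _ _ => ?_⟩
      change x0Fun y = _
      unfold x0Fun
      rw [zpow_neg_one]
      split_ifs <;> linarith

theorem x1_mem_F : x1 ∈ F := by
  refine mem_F_of_forall_notMem {1 / 2, 5 / 8, 3 / 4} (Set.toFinite _) ?_ fun x hx => ?_
  · rintro t (rfl | rfl | rfl)
    · exact ⟨1, 1, by norm_num⟩
    · exact ⟨5, 3, by norm_num⟩
    · exact ⟨3, 2, by norm_num⟩
  · simp only [mem_insert_iff, mem_singleton_iff, not_or] at hx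
    obtain ⟨h0, h1⟩ := x.2
    rcases lt_or_gt_of_ne hx.1 with h2 | h2
    · refine ⟨0, 0, affineNear_of_forall_Ioo (a := -1) (by linarith) h2 fun y _ _ => ?_⟩
      change x1Fun y = _
      unfold x1Fun
      rw [zpow_zero]
      split_ifs <;> linarith
    rcases lt_or_gt_of_ne hx.2.1 with h3 | h3
    · refine ⟨1, -(1 / 2), affineNear_of_forall_Ioo h2 h3 fun y _ _ => ?_⟩
      change x1Fun y = _
      unfold x1Fun
      rw [zpow_one]
      split_ifs <;> linarith
    rcases lt_or_gt_of_ne hx.2.2 with h4 | h4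
    · refine ⟨0, 1 / 8, affineNear_of_forall_Ioo h3 h4 fun y _ _ => ?_⟩
      change x1Fun y = _
      unfold x1Fun
      rw [zpow_zero]
      split_ifs <;> linarith
    · refine ⟨-1, 1 / 2, affineNear_of_forall_Ioo (b := 2) h4 (by linarith) fun y _ _ => ?_⟩
      change x1Fun y = _
      unfold x1Fun
      rw [zpow_neg_one]
      split_ifs <;> linarith

theorem genSubgroup_eq_F : genSubgroup = F := by
  refine le_antisymm ((Subgroup.closure_le _).2 ?_) F_le_genSubgroup
  rintro _ (rfl | rfl)
  · exact x0_mem_F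
  · exact x1_mem_F

/-! ### Copies supported in `[1/2, 3/4]`. -/

/-- `h` is supported in `[1/2, 3/4]` and is there the copy of `g` under `s ↦ 1/2 + s/4`. -/
def IsCopy (g h : PL0) : Prop :=
  (∀ t : unitInterval, (t : ℝ) ∉ Icc (1 / 2 : ℝ) (3 / 4) → h t = t) ∧
    ∀ s t : unitInterval, (t : ℝ) = 1 / 2 + s / 4 → (h t : ℝ) = 1 / 2 + g s / 4

/-- The point of `[1/2, 3/4]` corresponding to `s`. -/
noncomputable def copyPoint (s : unitInterval) : unitInterval :=
  ⟨1 / 2 + s / 4, by have := s.2.1; have := s.2.2; constructor <;> linarith⟩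

theorem IsCopy.one : IsCopy 1 1 := ⟨fun _ _ => rfl, fun _ _ h => h⟩

theorem IsCopy.mul {g h g' h' : PL0} (H : IsCopy g h) (H' : IsCopy g' h') :
    IsCopy (g * g') (h * h') := by
  refine ⟨fun t ht => ?_, fun s t hst => H'.2 (g s) (h t) (H.2 s t hst)⟩
  rw [PL0.mul_apply, H.1 t ht, H'.1 t ht]

theorem PL0.inv_apply_eq {f : PL0} {s t : unitInterval} : f⁻¹ t = s ↔ t = f s :=
  f.toHomeomorph.symm_apply_eq

theorem IsCopy.inv {g h : PL0} (H : IsCopy g h) : IsCopy g⁻¹ h⁻¹ := by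
  refine ⟨fun t ht => PL0.inv_apply_eq.2 (H.1 t ht).symm, fun s t hst => ?_⟩
  have h1 := H.2 (g⁻¹ s) (copyPoint (g⁻¹ s)) rfl
  have h2 : g (g⁻¹ s) = s := (PL0.inv_apply_eq.1 rfl).symm
  rw [h2, ← hst] at h1
  rw [PL0.inv_apply_eq.2 (Subtype.ext h1).symm]
  rfl

theorem IsCopy.left_unique {g g' h : PL0} (H : IsCopy g h) (H' : IsCopy g' h) : g = g' := by
  ext s
  have h1 := H.2 s (copyPoint s) rfl
  have h2 := H'.2 s (copyPoint s) rfl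
  linarith

theorem IsCopy.right_unique {g h h' : PL0} (H : IsCopy g h) (H' : IsCopy g h') : h = h' := by
  ext t
  by_cases ht : (t : ℝ) ∈ Icc (1 / 2 : ℝ) (3 / 4)
  · let s : unitInterval := ⟨4 * t - 2, by obtain ⟨h0, h1⟩ := ht; constructor <;> linarith⟩
    have hs : (t : ℝ) = 1 / 2 + (s : ℝ) / 4 := by
      change (t : ℝ) = 1 / 2 + (4 * t - 2) / 4
      ring
    rw [H.2 s t hs, H'.2 s t hs]
  · rw [H.1 t ht, H'.1 t ht]

/-- Subgroups generated by elements and by their copies are isomorphic. -/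
theorem nonempty_mulEquiv_of_isCopy {g₀ g₁ h₀ h₁ : PL0} (H₀ : IsCopy g₀ h₀) (H₁ : IsCopy g₁ h₁) :
    Nonempty ((Subgroup.closure {h₀, h₁} : Subgroup PL0) ≃*
      (Subgroup.closure {g₀, g₁} : Subgroup PL0)) := by
  -- The isomorphism is obtained from its graph: being a copy is preserved by the group operations
  -- and is unique in both directions, so both projections of `R` are injective.
  let R : Subgroup (PL0 × PL0) := Subgroup.closure {(g₀, h₀), (g₁, h₁)}
  have hR : ∀ p ∈ R, IsCopy p.1 p.2 := fun p hp => by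
    refine Subgroup.closure_induction ?_ IsCopy.one (fun _ _ _ _ h h' => h.mul h')
      (fun _ _ h => h.inv) hp
    rintro _ (rfl | rfl)
    · exact H₀
    · exact H₁
  have e₁ : ((MonoidHom.fst PL0 PL0).comp R.subtype).range = Subgroup.closure {g₀, g₁} := by
    rw [MonoidHom.range_comp, Subgroup.range_subtype, MonoidHom.map_closure]
    simp [Set.image_pair]
  have e₂ : ((MonoidHom.snd PL0 PL0).comp R.subtype).range = Subgroup.closure {h₀, h₁} := by
    rw [MonoidHom.range_comp, Subgroup.range_subtype, MonoidHom.map_closure]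
    simp [Set.image_pair]
  have i₁ : Function.Injective ((MonoidHom.fst PL0 PL0).comp R.subtype) := by
    rintro ⟨⟨a, b⟩, hp⟩ ⟨⟨a', b'⟩, hp'⟩ (h : a = a')
    subst h
    exact Subtype.ext (Prod.ext rfl ((hR _ hp).right_unique (hR _ hp')))
  have i₂ : Function.Injective ((MonoidHom.snd PL0 PL0).comp R.subtype) := by
    rintro ⟨⟨a, b⟩, hp⟩ ⟨⟨a', b'⟩, hp'⟩ (h : b = b')
    subst h
    exact Subtype.ext (Prod.ext ((hR _ hp).left_unique (hR _ hp')) rfl)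
  rw [← e₁, ← e₂]
  exact ⟨(MonoidHom.ofInjective i₂).symm.trans (MonoidHom.ofInjective i₁)⟩

/-! ### Explicit formulas for `f₀` and `f₁`. -/

theorem x_one : x 1 = x1 := by simp [x]

theorem x_two : x 2 = x0⁻¹ * x1 * x0 := by simp [x]

theorem x_three : x 3 = x0⁻¹ * x 2 * x0 := by
  simp only [x]
  group

theorem x_two_inv_apply (t : unitInterval) :
    (((x 2)⁻¹ t : unitInterval) : ℝ) = if (t : ℝ) ≤ 3 / 4 then (t : ℝ)
      else if (t : ℝ) ≤ 7 / 8 then (t : ℝ) / 2 + 3 / 8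
      else if (t : ℝ) ≤ 15 / 16 then (t : ℝ) - 1 / 16 else 2 * (t : ℝ) - 1 := by
  have : (x 2)⁻¹ = x0⁻¹ * (x1⁻¹ * x0) := by rw [x_two]; group
  rw [this]
  change x0Fun (x1Inv (x0Inv t)) = _
  generalize (t : ℝ) = a
  -- Simplifying an inner composition before applying the outer map keeps the number of cases small;
  -- the later formulas are handled likewise.
  have h1 : x1Inv (x0Inv a) = if a ≤ 3 / 4 then x0Inv a
      else if a ≤ 7 / 8 then a - 1 / 4
      else if a ≤ 15 / 16 then 2 * a - 9 / 8 else 4 * a - 3 := by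
    unfold x1Inv x0Inv
    split_ifs <;> linarith
  rw [h1]
  unfold x0Fun x0Inv
  split_ifs <;> linarith

/-- The element `x₁² x₂⁻¹ x₁⁻¹`. -/
noncomputable def copyX0 : PL0 := x 1 ^ 2 * (x 2)⁻¹ * (x 1)⁻¹

/-- The element `x₁ x₂² x₃⁻¹ x₂⁻¹ x₁⁻¹`. -/
noncomputable def copyX1 : PL0 := x 1 * x 2 ^ 2 * (x 3)⁻¹ * (x 2)⁻¹ * (x 1)⁻¹

theorem copyX0_apply (t : unitInterval) :
    (copyX0 t : ℝ) = if (t : ℝ) ≤ 1 / 2 then (t : ℝ)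
      else if (t : ℝ) ≤ 9 / 16 then 2 * (t : ℝ) - 1 / 2
      else if (t : ℝ) ≤ 5 / 8 then (t : ℝ) + 1 / 16
      else if (t : ℝ) ≤ 3 / 4 then (t : ℝ) / 2 + 3 / 8 else (t : ℝ) := by
  have : copyX0 = (x1 * x1) * ((x 2)⁻¹ * x1⁻¹) := by
    rw [copyX0, x_one, pow_two, mul_assoc]
  rw [this]
  change x1Inv ((x 2)⁻¹ ((x1 * x1) t) : unitInterval) = _
  rw [x_two_inv_apply]
  change x1Inv (if x1Fun (x1Fun t) ≤ 3 / 4 then x1Fun (x1Fun t)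
      else if x1Fun (x1Fun t) ≤ 7 / 8 then x1Fun (x1Fun t) / 2 + 3 / 8
      else if x1Fun (x1Fun t) ≤ 15 / 16 then x1Fun (x1Fun t) - 1 / 16
      else 2 * x1Fun (x1Fun t) - 1) = _
  generalize (t : ℝ) = a
  have h1 : x1Fun (x1Fun a) = if a ≤ 1 / 2 then a else if a ≤ 9 / 16 then 4 * a - 3 / 2
      else if a ≤ 5 / 8 then 2 * a - 3 / 8 else if a ≤ 3 / 4 then a / 2 + 9 / 16
      else a / 4 + 3 / 4 := by
    unfold x1Fun
    split_ifs <;> linarith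
  have h2 : ∀ b : ℝ, x1Inv (if b ≤ 3 / 4 then b else if b ≤ 7 / 8 then b / 2 + 3 / 8
      else if b ≤ 15 / 16 then b - 1 / 16 else 2 * b - 1) = if b ≤ 1 / 2 then b
      else if b ≤ 7 / 8 then b / 2 + 1 / 4 else if b ≤ 15 / 16 then b - 3 / 16
      else 4 * b - 3 := by
    intro b
    unfold x1Inv
    split_ifs <;> linarith
  rw [h2]
  generalize x1Fun (x1Fun a) = b at h1
  split_ifs at h1 ⊢ <;> linarith

theorem isCopy_x0 : IsCopy x0 copyX0 := by
  constructor
  · intro t ht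
    ext
    rw [copyX0_apply]
    rw [mem_Icc, not_and_or, not_le, not_le] at ht
    rcases ht with ht | ht <;> split_ifs <;> linarith
  · intro s t hst
    rw [copyX0_apply, hst]
    change _ = 1 / 2 + x0Fun s / 4
    obtain ⟨h0, h1⟩ := s.2
    unfold x0Fun
    split_ifs <;> linarith

/-- Conjugation by `x0` shifts the indices `1, 2` to `2, 3`, so `copyX1` is the conjugate of
`copyX0` by `x0 * x1⁻¹` and the formula for `copyX0` can be reused. -/
theorem copyX1_eq : copyX1 = (x1 * x0⁻¹) * copyX0 * (x0 * x1⁻¹) := by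
  have h : x 2 ^ 2 * (x 3)⁻¹ * (x 2)⁻¹ = x0⁻¹ * copyX0 * x0 := by
    rw [copyX0, x_three, x_one]
    -- The `x 2` coming from `x 3` and the one on the right stay folded, so the two sides match
    -- after cancellation.
    nth_rw 1 3 [x_two]
    simp only [pow_two, mul_inv_rev, inv_inv, mul_assoc, mul_inv_cancel_left]
  calc copyX1 = x1 * (x 2 ^ 2 * (x 3)⁻¹ * (x 2)⁻¹) * x1⁻¹ := by
        rw [copyX1, x_one]; simp only [mul_assoc]
    _ = _ := by rw [h]; simp only [mul_assoc]

theorem x0Inv_x1Fun (a : ℝ) : x0Inv (x1Fun a) = if a ≤ 1 / 2 then a / 2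
    else if a ≤ 3 / 4 then 2 * a - 3 / 4 else a := by
  unfold x0Inv x1Fun
  split_ifs <;> linarith

/-- On `[1/4, 3/4]` the conjugator is `c / 2 + 3 / 8`: it shrinks `[1/2, 3/4]` by half onto `[5/8,
3/4]`, just as `x1` is a half-size copy of `x0`. -/
theorem x1Inv_x0Fun (c : ℝ) : x1Inv (x0Fun c) = if c ≤ 1 / 4 then 2 * c
    else if c ≤ 3 / 4 then c / 2 + 3 / 8 else c := by
  unfold x0Fun x1Inv
  split_ifs <;> linarith

theorem x1Inv_x0Fun_copyX0_apply (t : unitInterval) :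
    x1Inv (x0Fun (copyX0 t : unitInterval)) = if (t : ℝ) ≤ 1 / 4 then 2 * (t : ℝ)
      else if (t : ℝ) ≤ 1 / 2 then (t : ℝ) / 2 + 3 / 8
      else if (t : ℝ) ≤ 9 / 16 then (t : ℝ) + 1 / 8
      else if (t : ℝ) ≤ 5 / 8 then (t : ℝ) / 2 + 13 / 32
      else if (t : ℝ) ≤ 3 / 4 then (t : ℝ) / 4 + 9 / 16 else (t : ℝ) := by
  have h := copyX0_apply t
  rw [x1Inv_x0Fun]
  generalize ((copyX0 t : unitInterval) : ℝ) = c at *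
  generalize (t : ℝ) = b at *
  split_ifs at h ⊢ <;> linarith

theorem copyX1_apply (t : unitInterval) :
    (copyX1 t : ℝ) = if (t : ℝ) ≤ 5 / 8 then (t : ℝ)
      else if (t : ℝ) ≤ 21 / 32 then 2 * (t : ℝ) - 5 / 8
      else if (t : ℝ) ≤ 11 / 16 then (t : ℝ) + 1 / 32
      else if (t : ℝ) ≤ 3 / 4 then (t : ℝ) / 2 + 3 / 8 else (t : ℝ) := by
  have h : (((x1 * x0⁻¹) t : unitInterval) : ℝ) = _ := x0Inv_x1Fun t
  rw [copyX1_eq]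
  change x1Inv (x0Fun (copyX0 ((x1 * x0⁻¹) t) : unitInterval)) = _
  rw [x1Inv_x0Fun_copyX0_apply]
  generalize (((x1 * x0⁻¹) t : unitInterval) : ℝ) = b at *
  generalize (t : ℝ) = a at *
  split_ifs at h ⊢ <;> linarith

theorem isCopy_x1 : IsCopy x1 copyX1 := by
  constructor
  · intro t ht
    ext
    rw [copyX1_apply]
    rw [mem_Icc, not_and_or, not_le, not_le] at ht
    rcases ht with ht | ht <;> split_ifs <;> linarith
  · intro s t hst
    rw [copyX1_apply, hst]
    change _ = 1 / 2 + x1Fun s / 4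
    obtain ⟨h0, h1⟩ := s.2
    unfold x1Fun
    split_ifs <;> linarith

/-! ### Behaviour near the end points, and the orbital. -/

theorem x0_apply (t : unitInterval) : (x0 t : ℝ) = x0Fun t := rfl

theorem lt_x0_apply {t : unitInterval} (ht : t ∈ Ioo (0 : unitInterval) 1) : t < x0 t := by
  have h0 : (0 : ℝ) < t := ht.1
  have h1 : (t : ℝ) < 1 := ht.2
  rw [← Subtype.coe_lt_coe, x0_apply]
  unfold x0Fun
  split_ifs <;> linarith

theorem le_x0_apply (t : unitInterval) : t ≤ x0 t := by
  obtain ⟨h0, h1⟩ := t.2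
  rw [← Subtype.coe_le_coe, x0_apply]
  unfold x0Fun
  split_ifs <;> linarith

theorem le_x0_pow_apply (n : ℕ) (t : unitInterval) : t ≤ (x0 ^ n) t := by
  induction n with
  | zero => exact le_refl t
  | succ n ih =>
    rw [pow_succ, PL0.mul_apply]
    exact ih.trans (le_x0_apply _)

/-- `x0` pushes interior points strictly to the right, so positive powers have no interior fixed
points, and a power and its inverse fix the same points. -/
theorem x0_zpow_apply_ne {n : ℤ} (hn : n ≠ 0) {t : unitInterval}
    (ht : t ∈ Ioo (0 : unitInterval) 1) : (x0 ^ n) t ≠ t := by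
  have key : ∀ m : ℕ, m ≠ 0 → (x0 ^ m) t ≠ t := fun m hm => by
    obtain ⟨k, rfl⟩ := Nat.exists_eq_succ_of_ne_zero hm
    rw [Nat.succ_eq_add_one, pow_succ', PL0.mul_apply]
    exact ((lt_x0_apply ht).trans_le (le_x0_pow_apply k _)).ne'
  obtain ⟨m, rfl | rfl⟩ := n.eq_nat_or_neg
  · rw [zpow_natCast]
    exact key m (by simpa using hn)
  · rw [zpow_neg, zpow_natCast, Ne, PL0.inv_apply_eq]
    exact (key m (by simpa using hn)).symm

theorem eventually_mul_eq {e : unitInterval} {f f' g g' : PL0} (he : f e = e)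
    (hf : ∀ᶠ t in 𝓝 e, f t = f' t) (hg : ∀ᶠ t in 𝓝 e, g t = g' t) :
    ∀ᶠ t in 𝓝 e, (f * g) t = (f' * g') t := by
  have hc : Tendsto f (𝓝 e) (𝓝 e) := by
    simpa only [he] using f.toHomeomorph.continuous.tendsto e
  filter_upwards [hf, hc.eventually hg] with t h1 h2
  rw [PL0.mul_apply, PL0.mul_apply, h2, h1]

theorem eventually_inv_eq {e : unitInterval} {f f' : PL0} (he : f e = e)
    (hf : ∀ᶠ t in 𝓝 e, f t = f' t) : ∀ᶠ t in 𝓝 e, f⁻¹ t = f'⁻¹ t := by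
  have hc : Tendsto (f⁻¹ : PL0) (𝓝 e) (𝓝 e) := by
    have := (f⁻¹).toHomeomorph.continuous.tendsto e
    rwa [show (f⁻¹).toHomeomorph e = e from PL0.inv_apply_eq.2 he.symm] at this
  filter_upwards [hc.eventually hf] with t ht
  have h1 : f (f⁻¹ t) = t := (PL0.inv_apply_eq.1 rfl).symm
  rw [h1] at ht
  exact (PL0.inv_apply_eq.2 ht).symm

theorem IsCopy.eventually_eq {g h : PL0} (H : IsCopy g h) :
    (∀ᶠ t in 𝓝 0, h t = (1 : PL0) t) ∧ ∀ᶠ t in 𝓝 1, h t = (1 : PL0) t := by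
  have hc : Continuous ((↑) : unitInterval → ℝ) := continuous_subtype_val
  constructor
  · filter_upwards [(hc.tendsto 0).eventually_lt_const
      (show ((0 : unitInterval) : ℝ) < 1 / 2 by norm_num)] with t ht
    exact H.1 t fun h => absurd h.1 (not_le.2 ht)
  · filter_upwards [(hc.tendsto 1).eventually_const_lt
      (show (3 / 4 : ℝ) < (1 : unitInterval) by norm_num)] with t ht
    exact H.1 t fun h => absurd h.2 (not_le.2 ht)

/-- The subgroup generated by `x₀` and copies in `[1/2, 3/4]` of two elements. -/
def extendedSubgroup (h₀ h₁ : PL0) : Subgroup PL0 := Subgroup.closure {x0, h₀, h₁}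

/-- The integer is the exponent sum of `x0` in a word for `h`: the copies are trivial near both
ends, and germs at a fixed point multiply. -/
theorem exists_zpow_of_mem_extendedSubgroup {g₀ g₁ h₀ h₁ h : PL0} (H₀ : IsCopy g₀ h₀)
    (H₁ : IsCopy g₁ h₁) (hh : h ∈ extendedSubgroup h₀ h₁) :
    ∃ n : ℤ, (∀ᶠ t in 𝓝 0, h t = (x0 ^ n) t) ∧ ∀ᶠ t in 𝓝 1, h t = (x0 ^ n) t := by
  induction hh using Subgroup.closure_induction with
  | mem y hy =>
    rcases hy with rfl | rfl | rfl
    · exact ⟨1, by simp, by simp⟩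
    · exact ⟨0, by simpa using H₀.eventually_eq⟩
    · exact ⟨0, by simpa using H₁.eventually_eq⟩
  | one => exact ⟨0, by simp, by simp⟩
  | mul f g _ _ hf hg =>
    obtain ⟨m, h1, h2⟩ := hf
    obtain ⟨n, h3, h4⟩ := hg
    refine ⟨m + n, ?_⟩
    rw [zpow_add]
    exact ⟨eventually_mul_eq f.map_zero h1 h3, eventually_mul_eq f.map_one h2 h4⟩
  | inv f _ hf =>
    obtain ⟨m, h1, h2⟩ := hf
    refine ⟨-m, ?_⟩
    rw [zpow_neg]
    exact ⟨eventually_inv_eq f.map_zero h1, eventually_inv_eq f.map_one h2⟩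

theorem movesPointsNear_iff {h : PL0} {n : ℤ} {e : unitInterval}
    (he : e ∈ closure (Ioo (0 : unitInterval) 1)) (hh : ∀ᶠ t in 𝓝 e, h t = (x0 ^ n) t) :
    MovesPointsNear h (Ioo 0 1) e ↔ n ≠ 0 := by
  -- A nontrivial filter is what allows passing from eventually to frequently below.
  have := mem_closure_iff_nhdsWithin_neBot.1 he
  have hh' := hh.filter_mono (nhdsWithin_le_nhds (s := Ioo 0 1))
  constructor
  · rintro hm rfl
    refine hm (hh'.mono fun t ht => not_not.2 ?_)
    rw [ht, zpow_zero, PL0.one_apply]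
  · intro hn
    refine Eventually.frequently ?_
    filter_upwards [hh', self_mem_nhdsWithin] with t h1 h2
    rw [h1]
    exact x0_zpow_apply_ne hn h2

theorem movesPointsNear_zero_iff_one {g₀ g₁ h₀ h₁ h : PL0} (H₀ : IsCopy g₀ h₀)
    (H₁ : IsCopy g₁ h₁) (hh : h ∈ extendedSubgroup h₀ h₁) :
    MovesPointsNear h (Ioo 0 1) 0 ↔ MovesPointsNear h (Ioo 0 1) 1 := by
  obtain ⟨n, h1, h2⟩ := exists_zpow_of_mem_extendedSubgroup H₀ H₁ hh
  have hc : closure (Ioo (0 : unitInterval) 1) = Icc 0 1 := closure_Ioo zero_ne_one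
  rw [movesPointsNear_iff (by rw [hc]; exact left_mem_Icc.2 zero_le_one) h1,
    movesPointsNear_iff (by rw [hc]; exact right_mem_Icc.2 zero_le_one) h2]

theorem supp_eq_of_x0_mem {H : Subgroup PL0} (hH : x0 ∈ H) : Supp H = Ioo 0 1 := by
  ext t
  constructor
  · rintro ⟨h, -, ht⟩
    refine ⟨lt_of_le_of_ne unitInterval.nonneg' ?_, lt_of_le_of_ne unitInterval.le_one' ?_⟩
    · rintro rfl
      exact ht h.map_zero
    · rintro rfl
      exact ht h.map_one
  · exact fun ht => ⟨x0, hH, (lt_x0_apply ht).ne'⟩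

theorem isOrbital_iff_of_x0_mem {H : Subgroup PL0} (hH : x0 ∈ H) (W : Set unitInterval) :
    IsOrbital H W ↔ W = Ioo 0 1 := by
  have hconn : ∀ t ∈ Ioo (0 : unitInterval) 1, connectedComponentIn (Ioo 0 1) t = Ioo 0 1 :=
    fun t ht => isPreconnected_Ioo.connectedComponentIn ht
  rw [IsOrbital, supp_eq_of_x0_mem hH]
  constructor
  · rintro ⟨t, ht, rfl⟩
    exact hconn t ht
  · rintro rfl
    obtain ⟨t, ht⟩ := exists_between (zero_lt_one (α := unitInterval))
    exact ⟨t, ht, (hconn t ht).symm⟩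

end ThompsonPL

theorem mainTheorem5 (f₀ f₁ : ThompsonPL.PL0) (H : Subgroup ThompsonPL.PL0)
    (hf₀ : f₀ = ThompsonPL.x 1 ^ 2 * (ThompsonPL.x 2)⁻¹ * (ThompsonPL.x 1)⁻¹)
    (hf₁ : f₁ = ThompsonPL.x 1 * ThompsonPL.x 2 ^ 2 * (ThompsonPL.x 3)⁻¹ *
      (ThompsonPL.x 2)⁻¹ * (ThompsonPL.x 1)⁻¹)
    (hH : H = Subgroup.closure {ThompsonPL.x 0, f₀, f₁}) :
    Nonempty ((Subgroup.closure {f₀, f₁} : Subgroup ThompsonPL.PL0) ≃* ThompsonPL.F) ∧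
    (∀ W : Set unitInterval, ThompsonPL.IsOrbital H W ↔ W = Set.Ioo 0 1) ∧
    (∀ h ∈ H, ThompsonPL.MovesPointsNear h (Set.Ioo 0 1) 0 ↔
      ThompsonPL.MovesPointsNear h (Set.Ioo 0 1) 1) ∧
    -- hence the full converse of the ubiquity theorem fails
    ¬ (∀ K : Subgroup ThompsonPL.PL0,
        (∃ G : Subgroup ThompsonPL.PL0, G ≤ K ∧ Nonempty (G ≃* ThompsonPL.F)) →
        ∃ a b : unitInterval, a < b ∧ ThompsonPL.IsOrbital K (Set.Ioo a b) ∧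
          ∃ h ∈ K,
            (ThompsonPL.MovesPointsNear h (Set.Ioo a b) a ∧
              ¬ ThompsonPL.MovesPointsNear h (Set.Ioo a b) b) ∨
            (ThompsonPL.MovesPointsNear h (Set.Ioo a b) b ∧
              ¬ ThompsonPL.MovesPointsNear h (Set.Ioo a b) a)) := by
  have c₀ : ThompsonPL.IsCopy ThompsonPL.x0 f₀ := hf₀ ▸ ThompsonPL.isCopy_x0
  have c₁ : ThompsonPL.IsCopy ThompsonPL.x1 f₁ := hf₁ ▸ ThompsonPL.isCopy_x1
  have hF : Nonempty ((Subgroup.closure {f₀, f₁} : Subgroup ThompsonPL.PL0) ≃* ThompsonPL.F) := by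
    rw [← ThompsonPL.genSubgroup_eq_F]
    exact ThompsonPL.nonempty_mulEquiv_of_isCopy c₀ c₁
  have hmem : ThompsonPL.x0 ∈ H := hH ▸ Subgroup.subset_closure (Set.mem_insert _ _)
  have horb := ThompsonPL.isOrbital_iff_of_x0_mem hmem
  have hmoves : ∀ h ∈ H, ThompsonPL.MovesPointsNear h (Set.Ioo 0 1) 0 ↔
      ThompsonPL.MovesPointsNear h (Set.Ioo 0 1) 1 := fun h hh =>
    ThompsonPL.movesPointsNear_zero_iff_one c₀ c₁ (hH ▸ hh : h ∈ Subgroup.closure _)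
  refine ⟨hF, horb, hmoves, fun hall => ?_⟩
  -- `H` itself is the counterexample, with `⟨f₀, f₁⟩` as its copy of `F`.
  obtain ⟨a, b, hab, hW, h, hh, hcases⟩ := hall H
    ⟨_, hH ▸ Subgroup.closure_mono (Set.subset_insert _ _), hF⟩
  have hIoo := (horb _).1 hW
  -- Passing to closures lets the end points be read off from equal nonempty closed intervals.
  have hIcc : Set.Icc a b = Set.Icc 0 1 := by
    rw [← closure_Ioo hab.ne, hIoo, closure_Ioo zero_ne_one]
  obtain ⟨rfl, rfl⟩ := (Set.Icc_eq_Icc_iff hab.le).1 hIcc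
  have := hmoves h hh
  tauto
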